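/- Let $\Omega=\{x\in\mathbb R^2:|x|<1\}$ with polar coordinates $(r,\phi)$. For trigonometric boundary data $f$, let $u_f$ be the harmonic function on $\Omega$ that is continuous on $\overline\Omega$ and equals $f$ on $\partial\Omega$. For $\gamma\in L^2(\Omega)$ let $$\langle\Lambda_\gamma' f,g\rangle=\int_\Omega\gamma\,\nabla u_f\cdot\nabla u_g\,dx$$ be the linearized (at conductivity $1$) Dirichlet-to-Neumann form. For integers $k,n\ge 0$ define the Müntz–Legendre polynomials $$L^k_n(x)=\sum_{l=0}^n\frac{\prod_{j=0}^{n-1}(l+j+k+1)}{\prod_{j=0,\,j\ne l}^{n}(l-j)}\,x^{2l+k}.$$ Let $N\ge 0$ and let $K^{cc},K^{ss},K^{sc},K^{cs}$ be real $N\times N$ matrices, indexed by $1,\dots,N$, such that $K^{cc}=K^{ss}$ is symmetric, $K^{cs}=(K^{sc})^T$, and $K^{cs}$, $K^{sc}$ are antisymmetric. Then there is a real-valued $\gamma\in L^2(\Omega)$ such that, for all $1\le i,j\le N$, $$K^{cc}_{i,j}=\langle\Lambda_\gamma'\cos(i\phi),\cos(j\phi)\rangle,\quad K^{ss}_{i,j}=\langle\Lambda_\gamma'\sin(i\phi),\sin(j\phi)\rangle,$$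 $$K^{sc}_{i,j}=\langle\Lambda_\gamma'\sin(i\phi),\cos(j\phi)\rangle,\quad K^{cs}_{i,j}=\langle\Lambda_\gamma'\cos(i\phi),\sin(j\phi)\rangle,$$ while all coefficients $\langle\Lambda'_\gamma f,g\rangle$ with $f$ or $g$ constant equal to $1$ and the other one among $\cos(j\phi),\sin(j\phi)$, $0\le j\le N$, vanish. This $\gamma$ can be taken of the form $$\gamma(r,\phi)=\frac12\sum_{n=0}^{N-1}L^0_n(r)\,p_{n,0}+\sum_{n=0}^{N-1}\sum_{k=1}^{N-(n+1)}L^k_n(r)\cos(k\phi)\,p_{n,k}+\sum_{n=0}^{N-1}\sum_{k=1}^{N-(n+1)}L^k_n(r)\sin(k\phi)\,q_{n,k},\qquad(*)$$ where $$p_{n,k}=\sum_{l=0}^n 2(-1)^{n-l}(2n+k+1)\frac{\prod_{j=0}^{n-1}(1+k+l+j)}{l!\,(n-l)!}\,\frac{K^{cc}_{l+1,l+1+k}}{(l+1)(l+1+k)\pi},$$ $$q_{n,k}=\sum_{l=0}^n 2(-1)^{n-l}(2n+k+1)\frac{\prod_{j=0}^{n-1}(1+k+l+j)}{l!\,(n-l)!}\,\frac{K^{cs}_{l+1,l+1+k}}{(l+1)(l+1+k)\pi}.$$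 These coefficients are uniquely determined by the matrices: whenever a function of the form $(*)$ has the given matrices as its coefficients for the frequencies $1,\dots,N$, its coefficients $p_{n,k}$ ($k\ge 0$, $n+k<N$) and $q_{n,k}$ ($k\ge1$, $n+k<N$) are the ones above. -/

import Mathlib

open MeasureTheory Metric InnerProductSpace
open scoped Gradient Nat

/-- The open unit disc, in the plane `ℝ² = ℂ` (with its Euclidean inner product and Lebesgue
measure). Polar coordinates of `z` are `r = ‖z‖`, `φ = Complex.arg z`. -/
abbrev unitDisc : Set ℂ := ball (0 : ℂ) 1

/-- `u` is a (classical) solution of the Dirichlet problem for the Laplace equation in the unit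
disc with boundary values `f`: continuous on the closed disc, harmonic in the open disc and equal
to `f` on the unit circle. Only the values of `f` on the unit circle matter. -/
def IsHarmonicExtension (f u : ℂ → ℝ) : Prop :=
  HarmonicContOnCl u unitDisc ∧ Set.EqOn u f (sphere 0 1)

/-- The solution of the Dirichlet problem is unique on the disc. -/
theorem IsHarmonicExtension.unique {f u v : ℂ → ℝ} (hu : IsHarmonicExtension f u)
    (hv : IsHarmonicExtension f v) : Set.EqOn u v unitDisc := by
  intro z hz
  have h1 := HarmonicContOnCl.circleAverage_poissonKernel_smul hu.1 hz
  have h2 := HarmonicContOnCl.circleAverage_poissonKernel_smul hv.1 hz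
  rw [← h1, ← h2]
  refine Real.circleAverage_congr_sphere ?_
  intro w hw
  have hw' : w ∈ sphere (0 : ℂ) 1 := by simpa using hw
  simp only [Pi.smul_apply', hu.2 hw', hv.2 hw']

open Classical in
/-- The solution `u_f` of the Dirichlet problem for the Laplace equation with boundary values `f`
(the zero function if there is none). -/
noncomputable def harmonicExtension (f : ℂ → ℝ) : ℂ → ℝ :=
  if h : ∃ u, IsHarmonicExtension f u then h.choose else 0

/-- The integrand `γ ∇u_f · ∇u_g` of the linearized Dirichlet-to-Neumann form. -/
noncomputable def linDtNIntegrand (γ f g : ℂ → ℝ) (z : ℂ) : ℝ :=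
  γ z * inner ℝ (∇ (harmonicExtension f) z) (∇ (harmonicExtension g) z)

/-- The value `⟨Λ' f, g⟩ = ∫_Ω γ ∇u_f · ∇u_g dx` of the linearized Dirichlet-to-Neumann map
(linearized at the conductivity `1`, in direction `γ`) exists and is equal to `κ`. -/
def HasLinDtNValue (γ f g : ℂ → ℝ) (κ : ℝ) : Prop :=
  IntegrableOn (linDtNIntegrand γ f g) unitDisc ∧ ∫ z in unitDisc, linDtNIntegrand γ f g z = κ

/-- The boundary function `cos (n φ)`. -/
noncomputable def cosMode (n : ℕ) (z : ℂ) : ℝ := Real.cos (n * Complex.arg z)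

/-- The boundary function `sin (n φ)`. -/
noncomputable def sinMode (n : ℕ) (z : ℂ) : ℝ := Real.sin (n * Complex.arg z)

/-- Real `N × N` matrices, with rows and columns indexed by the frequencies `1, …, N`. -/
abbrev FreqMatrix (N : ℕ) := Matrix (Finset.Icc 1 N) (Finset.Icc 1 N) ℝ

/-- The four matrices hold the coefficients of the linearized Dirichlet-to-Neumann map of `γ` in
the trigonometric basis, for the frequencies `1, …, N`. -/
def IsLinDtNData (N : ℕ) (γ : ℂ → ℝ) (Kcc Kss Ksc Kcs : FreqMatrix N) : Prop :=
  ∀ i j : Finset.Icc 1 N,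
    HasLinDtNValue γ (cosMode i) (cosMode j) (Kcc i j) ∧
    HasLinDtNValue γ (sinMode i) (sinMode j) (Kss i j) ∧
    HasLinDtNValue γ (sinMode i) (cosMode j) (Ksc i j) ∧
    HasLinDtNValue γ (cosMode i) (sinMode j) (Kcs i j)

/-- The entry of `K` at the frequencies `i`, `j`, extended by `0` beyond `1, …, N`. -/
noncomputable def FreqMatrix.entry {N : ℕ} (K : FreqMatrix N) (i j : ℕ) : ℝ :=
  if h : i ∈ Finset.Icc 1 N ∧ j ∈ Finset.Icc 1 N then K ⟨i, h.1⟩ ⟨j, h.2⟩ else 0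

/-- The coefficient of `x ^ (2 l + k)` in the Müntz–Legendre polynomial `muntzLegendre k n`. -/
noncomputable def muntzLegendreCoeff (k n l : ℕ) : ℝ :=
  (∏ j ∈ Finset.range n, ((l : ℝ) + j + k + 1)) /
    ∏ j ∈ (Finset.range (n + 1)).erase l, ((l : ℝ) - j)

/-- The Müntz–Legendre polynomial `L^k_n`, built from the monomials `x^k, x^(k+2), …, x^(k+2n)`
and orthogonal for the weight `x dx` on `[0, 1]`. -/
noncomputable def muntzLegendre (k n : ℕ) (x : ℝ) : ℝ :=
  ∑ l ∈ Finset.range (n + 1), muntzLegendreCoeff k n l * x ^ (2 * l + k)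

/-- The finite Müntz–Legendre / trigonometric expansion with coefficients `p n k`, `q n k`. -/
noncomputable def muntzTrigExpansion (N : ℕ) (p q : ℕ → ℕ → ℝ) (z : ℂ) : ℝ :=
  1 / 2 * ∑ n ∈ Finset.range N, muntzLegendre 0 n ‖z‖ * p n 0
    + ∑ n ∈ Finset.range N, ∑ k ∈ Finset.Icc 1 (N - (n + 1)),
        muntzLegendre k n ‖z‖ * Real.cos (k * Complex.arg z) * p n k
    + ∑ n ∈ Finset.range N, ∑ k ∈ Finset.Icc 1 (N - (n + 1)),
        muntzLegendre k n ‖z‖ * Real.sin (k * Complex.arg z) * q n k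

/-- The inversion formula for the coefficient of index `(n, k)`, from the entries
`K (l + 1) (l + 1 + k)`, `l = 0, …, n`. -/
noncomputable def inversionCoeff {N : ℕ} (K : FreqMatrix N) (n k : ℕ) : ℝ :=
  ∑ l ∈ Finset.range (n + 1),
    2 * (-1) ^ (n - l) * (2 * n + k + 1) *
      ((∏ j ∈ Finset.range n, (1 + (k : ℝ) + (l + j))) / ((l ! : ℝ) * ((n - l)! : ℝ))) *
      (K.entry (l + 1) (l + 1 + k) / ((l + 1) * (l + 1 + k) * Real.pi))

/-! The harmonic extensions of cos(nφ) and sin(nφ) are Re zⁿ and Im zⁿ, with gradients n z̄ⁿ⁻¹ and i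
n z̄ⁿ⁻¹. Pairing cos((l+1)φ) with the cosine or sine of frequency l+1+k therefore yields
(l+1)(l+1+k) times the moment of γ against r^(2l+k) cos(kφ) or r^(2l+k) sin(kφ). Since
multiplication by i is an isometry, the sin-sin and sin-cos values add nothing new.

For γ of the form (*), angular orthogonality isolates one frequency k and leaves a square system in
the unknowns with n < N - k, whose matrix is `muntzMoment k l n`. Orthogonality of the
Müntz–Legendre polynomials makes it triangular, and expanding ∫ L^k_n L^k_m r dr in monomials
exhibits its explicit inverse, which is the inversion formula
(`sum_muntzLegendreCoeff_mul_muntzMoment`, `muntzMoment_system_iff`). Invertibility gives existence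
and uniqueness together, through `eq_inversionCoeff_iff`. -/

/-! ### Müntz–Legendre moments and the inverse of the moment matrix -/

/-- The moment `∫₀¹ L^k_n(r) r ^ (2 l + k) r dr` of the Müntz–Legendre polynomial, in closed form. -/
noncomputable def muntzMoment (k l n : ℕ) : ℝ :=
  ∑ s ∈ Finset.range (n + 1), muntzLegendreCoeff k n s / (2 * ((l : ℝ) + s + k + 1))

/-- Partial fraction expansion with simple poles `0, …, n`. -/
theorem sum_eval_div_prod_erase (P : Polynomial ℝ) (n : ℕ) (hP : P.natDegree ≤ n) (x : ℝ)
    (hx : ∀ s ∈ Finset.range (n + 1), x ≠ (s : ℝ)) :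
    ∑ s ∈ Finset.range (n + 1),
      P.eval (s : ℝ) / (∏ j ∈ (Finset.range (n + 1)).erase s, ((s : ℝ) - j)) / (x - s) =
    P.eval x / ∏ j ∈ Finset.range (n + 1), (x - j) := by
  have hinj : Set.InjOn (fun i : ℕ => (i : ℝ)) (Finset.range (n + 1)) :=
    fun a _ b _ h => Nat.cast_injective h
  have hdeg : P.degree < ((Finset.range (n + 1)).card : ℕ) := by
    rw [Finset.card_range]
    exact lt_of_le_of_lt Polynomial.degree_le_natDegree (by exact_mod_cast Nat.lt_succ_of_le hP)
  have h := Lagrange.eq_interpolate hinj hdeg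
  -- Barycentric form of Lagrange interpolation at the nodes 0, …, n, exact because deg P ≤ n;
  -- dividing by the nodal polynomial gives the partial fractions.
  have h2 : P.eval x = _ :=
    (congrArg (Polynomial.eval x) h).trans
      (Lagrange.eval_interpolate_not_at_node (v := fun i : ℕ => (i : ℝ))
        (fun i => P.eval (i : ℝ)) hx)
  rw [h2, Lagrange.eval_nodal, mul_div_assoc, mul_div_left_comm, div_self, mul_one]
  · refine Finset.sum_congr rfl fun s _ => ?_
    rw [Lagrange.nodalWeight, Finset.prod_inv_distrib]
    simp only [div_eq_mul_inv]
    ring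
  · rw [Finset.prod_ne_zero_iff]
    exact fun s hs => sub_ne_zero.2 (hx s hs)

/-- The coefficients are residues: with P(x) = ∏ (x + j + k + 1), the sum is, up to sign, the
partial fraction expansion of P(x) / ∏ (x - j) evaluated at x = -(l + k + 1). -/
theorem sum_muntzLegendreCoeff_div (k n l : ℕ) :
    ∑ s ∈ Finset.range (n + 1), muntzLegendreCoeff k n s / ((l : ℝ) + s + k + 1) =
      (∏ j ∈ Finset.range n, ((l : ℝ) - j)) /
        ∏ j ∈ Finset.range (n + 1), ((l : ℝ) + k + 1 + j) := by
  let P : Polynomial ℝ :=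
    ∏ j ∈ Finset.range n, (Polynomial.X + Polynomial.C ((j : ℝ) + k + 1))
  have hev : ∀ x : ℝ, P.eval x = ∏ j ∈ Finset.range n, (x + j + k + 1) := by
    intro x
    rw [Polynomial.eval_prod]
    refine Finset.prod_congr rfl fun j _ => ?_
    simp only [Polynomial.eval_add, Polynomial.eval_X, Polynomial.eval_C]
    ring
  have hdeg : P.natDegree ≤ n := by
    refine (Polynomial.natDegree_prod_le _ _).trans ?_
    refine (Finset.sum_le_card_nsmul _ _ 1 fun j _ => ?_).trans (by simp)
    exact (Polynomial.natDegree_X_add_C _).le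
  have hx : ∀ s ∈ Finset.range (n + 1), (-((l : ℝ) + k + 1)) ≠ (s : ℝ) := by
    intro s _ h
    have h1 : (0 : ℝ) ≤ s := Nat.cast_nonneg s
    have h2 : (0 : ℝ) < (l : ℝ) + k + 1 := by positivity
    linarith
  have h := sum_eval_div_prod_erase P n hdeg _ hx
  have hl : ∑ s ∈ Finset.range (n + 1), muntzLegendreCoeff k n s / ((l : ℝ) + s + k + 1) =
      - (P.eval (-((l : ℝ) + k + 1)) /
        ∏ j ∈ Finset.range (n + 1), (-((l : ℝ) + k + 1) - j)) := by
    rw [← h, ← Finset.sum_neg_distrib]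
    refine Finset.sum_congr rfl fun s _ => ?_
    rw [muntzLegendreCoeff, hev, ← div_neg]
    congr 1
    ring
  rw [hl, hev]
  have e1 : ∏ j ∈ Finset.range n, (-((l : ℝ) + k + 1) + j + k + 1) =
      (-1) ^ n * ∏ j ∈ Finset.range n, ((l : ℝ) - j) := by
    rw [← Finset.card_range n, ← Finset.prod_const, Finset.card_range, ← Finset.prod_mul_distrib]
    exact Finset.prod_congr rfl fun j _ => by ring
  have e2 : ∏ j ∈ Finset.range (n + 1), (-((l : ℝ) + k + 1) - j) =
      (-1) ^ (n + 1) * ∏ j ∈ Finset.range (n + 1), ((l : ℝ) + k + 1 + j) := by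
    rw [← Finset.card_range (n + 1), ← Finset.prod_const, Finset.card_range,
      ← Finset.prod_mul_distrib]
    exact Finset.prod_congr rfl fun j _ => by ring
  rw [e1, e2, pow_succ, mul_neg_one, neg_mul, div_neg, neg_neg, mul_div_mul_left]
  exact pow_ne_zero _ (by norm_num)

theorem muntzMoment_eq (k l n : ℕ) :
    muntzMoment k l n = (∏ j ∈ Finset.range n, ((l : ℝ) - j)) /
        (∏ j ∈ Finset.range (n + 1), ((l : ℝ) + k + 1 + j)) / 2 := by
  rw [← sum_muntzLegendreCoeff_div, muntzMoment, Finset.sum_div]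
  refine Finset.sum_congr rfl fun s _ => ?_
  rw [div_div, mul_comm (2 : ℝ)]

/-- Orthogonality of L^k_n to the lower powers x^(2l+k): the numerator ∏ (l - j) contains the factor
j = l. This makes the moment matrix triangular. -/
theorem muntzMoment_eq_zero {k l n : ℕ} (h : l < n) : muntzMoment k l n = 0 := by
  rw [muntzMoment_eq, Finset.prod_eq_zero (Finset.mem_range.2 h) (sub_self _), zero_div, zero_div]

theorem prod_range_natCast_sub_self (n : ℕ) :
    ∏ j ∈ Finset.range n, ((n : ℝ) - j) = (n ! : ℝ) := by
  have : ∀ j ∈ Finset.range n, ((n : ℝ) - j) = (((n - 1 - j) + 1 : ℕ) : ℝ) := by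
    intro j hj
    have := Finset.mem_range.1 hj
    rw [show n - 1 - j + 1 = n - j by omega, Nat.cast_sub this.le]
  rw [Finset.prod_congr rfl this, Finset.prod_range_reflect (fun j => ((j + 1 : ℕ) : ℝ)) n,
    ← Nat.cast_prod, Finset.prod_range_add_one_eq_factorial]

/-- The indices below l contribute l!, those above l contribute (-1)^(n-l) (n-l)!. -/
theorem prod_erase_range_natCast_sub {n l : ℕ} (h : l ≤ n) :
    ∏ j ∈ (Finset.range (n + 1)).erase l, ((l : ℝ) - j) =
      (-1) ^ (n - l) * ((l ! : ℝ) * ((n - l)! : ℝ)) := by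
  obtain ⟨m, rfl⟩ := Nat.exists_eq_add_of_le h
  have hset : (Finset.range (l + m + 1)).erase l =
      (Finset.range l).disjUnion ((Finset.range m).map (addLeftEmbedding (l + 1)))
        (by
          rw [Finset.disjoint_left]
          intro a ha hb
          simp only [Finset.mem_map, Finset.mem_range, addLeftEmbedding_apply] at ha hb
          omega) := by
    ext a
    simp only [Finset.mem_erase, Finset.mem_range, Finset.mem_disjUnion, Finset.mem_map,
      addLeftEmbedding_apply]
    constructor
    · intro ⟨h1, h2⟩
      by_cases h3 : a < l
      · exact Or.inl h3
      · exact Or.inr ⟨a - (l + 1), by omega, by omega⟩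
    · rintro (h1 | ⟨b, h1, rfl⟩) <;> omega
  rw [hset, Finset.prod_disjUnion, prod_range_natCast_sub_self, Finset.prod_map]
  have : ∀ j ∈ Finset.range m,
      ((l : ℝ) - (addLeftEmbedding (l + 1) j : ℕ)) = (-1) * ((j + 1 : ℕ) : ℝ) := by
    intro j _
    simp only [addLeftEmbedding_apply]
    push_cast
    ring
  rw [Finset.prod_congr rfl this, Finset.prod_mul_distrib, Finset.prod_const, Finset.card_range,
    ← Nat.cast_prod, Finset.prod_range_add_one_eq_factorial, Nat.add_sub_cancel_left]
  ring

theorem muntzLegendreCoeff_eq {k n l : ℕ} (h : l ≤ n) :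
    muntzLegendreCoeff k n l = (-1) ^ (n - l) *
      ((∏ j ∈ Finset.range n, (1 + (k : ℝ) + (l + j))) / ((l ! : ℝ) * ((n - l)! : ℝ))) := by
  have h1 : ∀ a b : ℝ, a / ((-1) ^ (n - l) * b) = (-1) ^ (n - l) * (a / b) := by
    intro a b
    rw [div_mul_eq_div_div, div_eq_mul_inv a, ← inv_pow, inv_neg_one, mul_comm a, mul_div_assoc]
  rw [muntzLegendreCoeff, prod_erase_range_natCast_sub h, h1]
  have h2 : ∏ j ∈ Finset.range n, ((l : ℝ) + j + k + 1) =
      ∏ j ∈ Finset.range n, (1 + (k : ℝ) + (l + j)) :=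
    Finset.prod_congr rfl fun j _ => by ring
  rw [h2]

/-- Biorthogonality of the inversion coefficients and the moments. -/
theorem sum_muntzLegendreCoeff_mul_muntzMoment (k n m : ℕ) :
    ∑ l ∈ Finset.range (n + 1),
      2 * (2 * (n : ℝ) + k + 1) * muntzLegendreCoeff k n l * muntzMoment k l m =
    if n = m then 1 else 0 := by
  -- The sum is 2(2n+k+1) ∫ L^k_n L^k_m r dr, expanded in the monomials of L^k_n. For n < m every
  -- moment vanishes; for n = m only l = n survives.
  rcases lt_trichotomy n m with h | h | h
  · rw [if_neg h.ne]
    refine Finset.sum_eq_zero fun l hl => ?_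
    have := Finset.mem_range.1 hl
    rw [muntzMoment_eq_zero (by omega), mul_zero]
  · subst h
    rw [if_pos rfl, Finset.sum_eq_single n, muntzMoment_eq, muntzLegendreCoeff_eq le_rfl,
      prod_range_natCast_sub_self, Finset.prod_range_succ, Nat.sub_self]
    · have h1 : ∏ j ∈ Finset.range n, ((n : ℝ) + k + 1 + j) ≠ 0 :=
        Finset.prod_ne_zero_iff.2 fun j _ => by positivity
      have h2 : ∏ j ∈ Finset.range n, (1 + (k : ℝ) + (n + j)) =
          ∏ j ∈ Finset.range n, ((n : ℝ) + k + 1 + j) :=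
        Finset.prod_congr rfl fun j _ => by ring
      have h3 : (n : ℝ) + k + 1 + n ≠ 0 := by positivity
      have h4 : (n ! : ℝ) ≠ 0 := by positivity
      rw [h2]
      field_simp
      simp
      ring
    · intro l hl hne
      have := Finset.mem_range.1 hl
      rw [muntzMoment_eq_zero (by omega), mul_zero]
    · intro h
      exact absurd (Finset.mem_range.2 (Nat.lt_succ_self n)) h
  · rw [if_neg h.ne']
    -- For n > m, expand the moment as well and exchange the sums: the inner sums become moments of
    -- L^k_n against powers of index s ≤ m < n.
    have : ∀ l ∈ Finset.range (n + 1),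
        2 * (2 * (n : ℝ) + k + 1) * muntzLegendreCoeff k n l * muntzMoment k l m =
        ∑ s ∈ Finset.range (m + 1), 2 * (2 * (n : ℝ) + k + 1) * muntzLegendreCoeff k m s *
          (muntzLegendreCoeff k n l / (2 * ((s : ℝ) + l + k + 1))) := by
      intro l _
      rw [muntzMoment, Finset.mul_sum]
      refine Finset.sum_congr rfl fun s _ => ?_
      rw [add_comm (l : ℝ)]
      ring
    rw [Finset.sum_congr rfl this, Finset.sum_comm]
    refine Finset.sum_eq_zero fun s hs => ?_
    have := Finset.mem_range.1 hs
    rw [← Finset.mul_sum]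
    change _ * muntzMoment k s n = 0
    rw [muntzMoment_eq_zero (by omega), mul_zero]

/-- The triangular system `a l = ∑ n, muntzMoment k l n * p n`, `l < d`, and its solution. -/
theorem muntzMoment_system_iff (k d : ℕ) (a p : ℕ → ℝ) :
    (∀ l < d, a l = ∑ n ∈ Finset.range d, muntzMoment k l n * p n) ↔
    ∀ n < d, p n = ∑ l ∈ Finset.range (n + 1),
      2 * (2 * (n : ℝ) + k + 1) * muntzLegendreCoeff k n l * a l := by
  let M : Matrix (Fin d) (Fin d) ℝ := fun l n => muntzMoment k l n
  let C : Matrix (Fin d) (Fin d) ℝ := fun n l =>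
    if (l : ℕ) ∈ Finset.range ((n : ℕ) + 1) then
      2 * (2 * ((n : ℕ) : ℝ) + k + 1) * muntzLegendreCoeff k n l else 0
  have key : ∀ (n : Fin d) (b : ℕ → ℝ), ∑ l : Fin d, C n l * b l =
      ∑ l ∈ Finset.range ((n : ℕ) + 1),
        2 * (2 * ((n : ℕ) : ℝ) + k + 1) * muntzLegendreCoeff k n l * b l := by
    intro n b
    have hsub : Finset.range ((n : ℕ) + 1) ⊆ Finset.range d :=
      Finset.range_subset_range.2 n.2
    rw [← Finset.inter_eq_right.2 hsub, ← Finset.sum_ite_mem, ← Fin.sum_univ_eq_sum_range (fun l =>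
      if l ∈ Finset.range ((n : ℕ) + 1) then
        2 * (2 * ((n : ℕ) : ℝ) + k + 1) * muntzLegendreCoeff k n l * b l else 0) d]
    refine Finset.sum_congr rfl fun l _ => ?_
    simp only [C, ite_mul, zero_mul]
  have hCM : C * M = 1 := by
    ext n m
    rw [Matrix.mul_apply, Matrix.one_apply]
    simp only [Fin.ext_iff]
    rw [← sum_muntzLegendreCoeff_mul_muntzMoment k n m]
    exact key n fun l => muntzMoment k l m
  -- A left inverse of a square matrix is two-sided; one product gives uniqueness, the other
  -- existence.
  have hMC : M * C = 1 := mul_eq_one_comm.1 hCM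
  let a' : Fin d → ℝ := fun l => a l
  let p' : Fin d → ℝ := fun n => p n
  have hL : (∀ l < d, a l = ∑ n ∈ Finset.range d, muntzMoment k l n * p n) ↔ a' = M.mulVec p' := by
    constructor
    · intro h
      funext l
      exact (h l l.2).trans (Fin.sum_univ_eq_sum_range (fun n => muntzMoment k l n * p n) d).symm
    · intro h l hl
      exact (congrFun h ⟨l, hl⟩).trans
        (Fin.sum_univ_eq_sum_range (fun n => muntzMoment k l n * p n) d)
  have hR : (∀ n < d, p n = ∑ l ∈ Finset.range (n + 1),
      2 * (2 * (n : ℝ) + k + 1) * muntzLegendreCoeff k n l * a l) ↔ p' = C.mulVec a' := by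
    constructor
    · intro h
      funext n
      exact (h n n.2).trans (key n a).symm
    · intro h n hn
      exact (congrFun h ⟨n, hn⟩).trans (key ⟨n, hn⟩ a)
  rw [hL, hR]
  constructor
  · intro h
    rw [h, Matrix.mulVec_mulVec, hCM, Matrix.one_mulVec]
  · intro h
    rw [h, Matrix.mulVec_mulVec, hMC, Matrix.one_mulVec]

theorem inversionCoeff_eq {N : ℕ} (K : FreqMatrix N) (n k : ℕ) :
    inversionCoeff K n k = ∑ l ∈ Finset.range (n + 1),
      2 * (2 * (n : ℝ) + k + 1) * muntzLegendreCoeff k n l *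
        (K.entry (l + 1) (l + 1 + k) / ((l + 1) * (l + 1 + k) * Real.pi)) := by
  refine Finset.sum_congr rfl fun l hl => ?_
  rw [muntzLegendreCoeff_eq (Nat.lt_succ_iff.1 (Finset.mem_range.1 hl))]
  ring

/-! ### Harmonic extensions of the trigonometric modes and their gradients -/

theorem Complex.re_pow_eq (z : ℂ) (n : ℕ) :
    (z ^ n).re = ‖z‖ ^ n * Real.cos (n * Complex.arg z) := by
  conv_lhs => rw [← Complex.norm_mul_exp_arg_mul_I z, mul_pow, ← Complex.exp_nat_mul,
    ← Complex.ofReal_pow, Complex.re_ofReal_mul, ← mul_assoc, ← Complex.ofReal_natCast,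
    ← Complex.ofReal_mul, Complex.exp_ofReal_mul_I_re]

theorem Complex.im_pow_eq (z : ℂ) (n : ℕ) :
    (z ^ n).im = ‖z‖ ^ n * Real.sin (n * Complex.arg z) := by
  conv_lhs => rw [← Complex.norm_mul_exp_arg_mul_I z, mul_pow, ← Complex.exp_nat_mul,
    ← Complex.ofReal_pow, Complex.im_ofReal_mul, ← mul_assoc, ← Complex.ofReal_natCast,
    ← Complex.ofReal_mul, Complex.exp_ofReal_mul_I_im]

theorem isHarmonicExtension_cosMode (n : ℕ) :
    IsHarmonicExtension (cosMode n) fun z => (z ^ n).re := by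
  refine ⟨HarmonicOnNhd.harmonicContOnCl fun z _ => ?_, fun z hz => ?_⟩
  · exact AnalyticAt.harmonicAt_re (f := fun z : ℂ => z ^ n) (by fun_prop)
  · have : ‖z‖ = 1 := by simpa using hz
    simp only [Complex.re_pow_eq, this, one_pow, one_mul, cosMode]

theorem isHarmonicExtension_sinMode (n : ℕ) :
    IsHarmonicExtension (sinMode n) fun z => (z ^ n).im := by
  refine ⟨HarmonicOnNhd.harmonicContOnCl fun z _ => ?_, fun z hz => ?_⟩
  · exact AnalyticAt.harmonicAt_im (f := fun z : ℂ => z ^ n) (by fun_prop)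
  · have : ‖z‖ = 1 := by simpa using hz
    simp only [Complex.im_pow_eq, this, one_pow, one_mul, sinMode]

theorem IsHarmonicExtension.harmonicExtension_eqOn {f u : ℂ → ℝ} (h : IsHarmonicExtension f u) :
    Set.EqOn (harmonicExtension f) u unitDisc := by
  have hex : ∃ u, IsHarmonicExtension f u := ⟨u, h⟩
  rw [harmonicExtension, dif_pos hex]
  exact hex.choose_spec.unique h

theorem IsHarmonicExtension.gradient_eq {f u : ℂ → ℝ} (h : IsHarmonicExtension f u) {z : ℂ}
    (hz : z ∈ unitDisc) : ∇ (harmonicExtension f) z = ∇ u z := by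
  -- The chosen extension is arbitrary away from the closed disc, but a gradient depends only on the
  -- germ and the disc is open.
  have : harmonicExtension f =ᶠ[nhds z] u :=
    h.harmonicExtension_eqOn.eventuallyEq_of_mem (isOpen_ball.mem_nhds hz)
  rw [gradient, gradient, this.fderiv_eq]

theorem HasDerivAt.hasGradientAt_re {f : ℂ → ℂ} {f' z : ℂ} (h : HasDerivAt f f' z) :
    HasGradientAt (fun w => (f w).re) (starRingEnd ℂ f') z := by
  rw [hasGradientAt_iff_hasFDerivAt]
  have h1 := Complex.reCLM.hasFDerivAt.comp z (h.hasFDerivAt.restrictScalars ℝ)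
  refine h1.congr_fderiv ?_
  ext v
  simp [Complex.inner]

/-- Im(f' v) = Re(-i f' v), which is the real inner product of i·conj f' with v. -/
theorem HasDerivAt.hasGradientAt_im {f : ℂ → ℂ} {f' z : ℂ} (h : HasDerivAt f f' z) :
    HasGradientAt (fun w => (f w).im) (Complex.I * starRingEnd ℂ f') z := by
  rw [hasGradientAt_iff_hasFDerivAt]
  have h1 := Complex.imCLM.hasFDerivAt.comp z (h.hasFDerivAt.restrictScalars ℝ)
  refine h1.congr_fderiv ?_
  ext v
  simp [Complex.inner]
  ring

theorem gradient_harmonicExtension_cosMode (n : ℕ) {z : ℂ} (hz : z ∈ unitDisc) :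
    ∇ (harmonicExtension (cosMode n)) z = n * starRingEnd ℂ z ^ (n - 1) := by
  rw [(isHarmonicExtension_cosMode n).gradient_eq hz, (hasDerivAt_pow n z).hasGradientAt_re.gradient]
  simp

theorem gradient_harmonicExtension_sinMode (n : ℕ) {z : ℂ} (hz : z ∈ unitDisc) :
    ∇ (harmonicExtension (sinMode n)) z = Complex.I * (n * starRingEnd ℂ z ^ (n - 1)) := by
  rw [(isHarmonicExtension_sinMode n).gradient_eq hz, (hasDerivAt_pow n z).hasGradientAt_im.gradient]
  simp

/-- The product z^l z̄^(l+k) equals |z|^(2l) z̄^k, so only the frequency difference k remains in the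
angle. -/
theorem inner_conj_pow (z : ℂ) (l k : ℕ) :
    inner ℝ (starRingEnd ℂ z ^ l) (starRingEnd ℂ z ^ (l + k)) =
      ‖z‖ ^ (2 * l + k) * Real.cos (k * Complex.arg z) := by
  rw [Complex.inner, pow_add, map_pow, Complex.conj_conj, mul_right_comm, ← mul_pow,
    ← Complex.normSq_eq_conj_mul_self, ← Complex.ofReal_pow, Complex.re_ofReal_mul, ← map_pow (starRingEnd ℂ),
    Complex.conj_re, Complex.re_pow_eq, Complex.normSq_eq_norm_sq]
  ring

theorem inner_conj_pow_I_mul (z : ℂ) (l k : ℕ) :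
    inner ℝ (starRingEnd ℂ z ^ l) (Complex.I * starRingEnd ℂ z ^ (l + k)) =
      ‖z‖ ^ (2 * l + k) * Real.sin (k * Complex.arg z) := by
  rw [Complex.inner, pow_add, map_pow, Complex.conj_conj, mul_assoc, mul_right_comm, ← mul_pow,
    ← Complex.normSq_eq_conj_mul_self, ← Complex.ofReal_pow, Complex.I_mul_re,
    Complex.im_ofReal_mul, ← map_pow (starRingEnd ℂ),
    Complex.conj_im, Complex.im_pow_eq, Complex.normSq_eq_norm_sq]
  ring

theorem inner_I_mul_I_mul (x y : ℂ) : inner ℝ (Complex.I * x) (Complex.I * y) = inner ℝ x y := by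
  simp [Complex.inner]

theorem inner_I_mul_left (x y : ℂ) : inner ℝ (Complex.I * x) y = - inner ℝ x (Complex.I * y) := by
  simp [Complex.inner]
  ring

theorem inner_natCast_mul_natCast_mul (m n : ℕ) (x y : ℂ) :
    inner ℝ ((m : ℂ) * x) ((n : ℂ) * y) = (m : ℝ) * n * inner ℝ x y := by
  simp [Complex.inner]
  ring

/-! ### The linearized form on pairs of modes -/

theorem linDtNIntegrand_comm (γ f g : ℂ → ℝ) : linDtNIntegrand γ f g = linDtNIntegrand γ g f := by
  funext z
  rw [linDtNIntegrand, linDtNIntegrand, real_inner_comm]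

theorem HasLinDtNValue.symm {γ f g : ℂ → ℝ} {κ : ℝ} (h : HasLinDtNValue γ f g κ) :
    HasLinDtNValue γ g f κ := by
  rwa [HasLinDtNValue, linDtNIntegrand_comm]

theorem linDtNIntegrand_cos_cos (γ : ℂ → ℝ) (l k : ℕ) {z : ℂ} (hz : z ∈ unitDisc) :
    linDtNIntegrand γ (cosMode (l + 1)) (cosMode (l + 1 + k)) z =
      ((l : ℝ) + 1) * (l + 1 + k) *
        (γ z * (‖z‖ ^ (2 * l + k) * Real.cos (k * Complex.arg z))) := by
  rw [linDtNIntegrand, gradient_harmonicExtension_cosMode _ hz,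
    gradient_harmonicExtension_cosMode _ hz, inner_natCast_mul_natCast_mul, Nat.add_sub_cancel,
    show l + 1 + k - 1 = l + k by omega, inner_conj_pow]
  push_cast
  ring

theorem linDtNIntegrand_cos_sin (γ : ℂ → ℝ) (l k : ℕ) {z : ℂ} (hz : z ∈ unitDisc) :
    linDtNIntegrand γ (cosMode (l + 1)) (sinMode (l + 1 + k)) z =
      ((l : ℝ) + 1) * (l + 1 + k) *
        (γ z * (‖z‖ ^ (2 * l + k) * Real.sin (k * Complex.arg z))) := by
  rw [linDtNIntegrand, gradient_harmonicExtension_cosMode _ hz,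
    gradient_harmonicExtension_sinMode _ hz, mul_left_comm, inner_natCast_mul_natCast_mul,
    Nat.add_sub_cancel, show l + 1 + k - 1 = l + k by omega, inner_conj_pow_I_mul]
  push_cast
  ring

theorem linDtNIntegrand_sin_sin (γ : ℂ → ℝ) (i j : ℕ) {z : ℂ} (hz : z ∈ unitDisc) :
    linDtNIntegrand γ (sinMode i) (sinMode j) z = linDtNIntegrand γ (cosMode i) (cosMode j) z := by
  rw [linDtNIntegrand, linDtNIntegrand, gradient_harmonicExtension_cosMode _ hz,
    gradient_harmonicExtension_cosMode _ hz, gradient_harmonicExtension_sinMode _ hz,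
    gradient_harmonicExtension_sinMode _ hz, inner_I_mul_I_mul]

/-- Multiplication by i is skew for the real inner product. Hence the antisymmetry of the mixed
matrices holds for every γ. -/
theorem linDtNIntegrand_sin_cos (γ : ℂ → ℝ) (i j : ℕ) {z : ℂ} (hz : z ∈ unitDisc) :
    linDtNIntegrand γ (sinMode i) (cosMode j) z =
      -linDtNIntegrand γ (cosMode i) (sinMode j) z := by
  rw [linDtNIntegrand, linDtNIntegrand, gradient_harmonicExtension_cosMode _ hz,
    gradient_harmonicExtension_cosMode _ hz, gradient_harmonicExtension_sinMode _ hz,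
    gradient_harmonicExtension_sinMode _ hz, inner_I_mul_left, mul_neg]

theorem HasLinDtNValue.congr {γ f g f' g' : ℂ → ℝ} {κ : ℝ} (h : HasLinDtNValue γ f g κ)
    (hc : ∀ z ∈ unitDisc, linDtNIntegrand γ f' g' z = linDtNIntegrand γ f g z) :
    HasLinDtNValue γ f' g' κ :=
  ⟨h.1.congr_fun (fun z hz => (hc z hz).symm) measurableSet_ball,
    (setIntegral_congr_fun measurableSet_ball hc).trans h.2⟩

theorem HasLinDtNValue.sin_sin {γ : ℂ → ℝ} {i j : ℕ} {κ : ℝ}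
    (h : HasLinDtNValue γ (cosMode i) (cosMode j) κ) :
    HasLinDtNValue γ (sinMode i) (sinMode j) κ :=
  h.congr fun _ hz => linDtNIntegrand_sin_sin γ i j hz

theorem HasLinDtNValue.sin_cos {γ : ℂ → ℝ} {i j : ℕ} {κ : ℝ}
    (h : HasLinDtNValue γ (cosMode i) (sinMode j) κ) :
    HasLinDtNValue γ (sinMode i) (cosMode j) (-κ) := by
  have hc : ∀ z ∈ unitDisc, linDtNIntegrand γ (sinMode i) (cosMode j) z =
      (-linDtNIntegrand γ (cosMode i) (sinMode j)) z :=
    fun _ hz => linDtNIntegrand_sin_cos γ i j hz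
  refine ⟨h.1.neg.congr_fun (fun z hz => (hc z hz).symm) measurableSet_ball, ?_⟩
  rw [setIntegral_congr_fun measurableSet_ball hc, ← h.2]
  exact integral_neg _

theorem hasLinDtNValue_cosMode_zero (γ g : ℂ → ℝ) : HasLinDtNValue γ (cosMode 0) g 0 := by
  have hc : ∀ z ∈ unitDisc, linDtNIntegrand γ (cosMode 0) g z = 0 := by
    intro z hz
    rw [linDtNIntegrand, gradient_harmonicExtension_cosMode _ hz]
    simp
  refine ⟨integrableOn_zero.congr_fun (fun z hz => (hc z hz).symm) measurableSet_ball, ?_⟩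
  rw [setIntegral_congr_fun measurableSet_ball hc, integral_zero]

/-! ### Polar coordinates and trigonometric integrals -/

/-- Integration over the unit disc of a product of a radial and an angular function. -/
theorem setIntegral_unitDisc_norm_mul_arg (F G : ℝ → ℝ) :
    ∫ z in unitDisc, F ‖z‖ * G (Complex.arg z) =
      (∫ r in (0 : ℝ)..1, r * F r) * ∫ θ in (-Real.pi)..Real.pi, G θ := by
  rw [← integral_indicator measurableSet_ball, ← Complex.integral_comp_polarCoord_symm,
    polarCoord_target]
  have h : ∀ p ∈ Set.Ioi (0 : ℝ) ×ˢ Set.Ioo (-Real.pi) Real.pi,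
      p.1 • unitDisc.indicator (fun z => F ‖z‖ * G (Complex.arg z)) (Complex.polarCoord.symm p) =
      (Set.Iio (1 : ℝ)).indicator (fun r => r * F r) p.1 * G p.2 := by
    rintro ⟨r, θ⟩ ⟨hr, hθ⟩
    have hr' : 0 < r := hr
    have hn : ‖Complex.polarCoord.symm (r, θ)‖ = r := by
      rw [Complex.norm_polarCoord_symm, abs_of_pos hr']
    have ha : Complex.arg (Complex.polarCoord.symm (r, θ)) = θ := by
      rw [Complex.polarCoord_symm_apply]
      push_cast
      exact Complex.arg_mul_cos_add_sin_mul_I hr' ⟨hθ.1, hθ.2.le⟩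
    by_cases h1 : r < 1
    · rw [Set.indicator_of_mem (by rw [mem_ball_zero_iff, hn]; exact h1),
        Set.indicator_of_mem (by exact h1), hn, ha, smul_eq_mul, mul_assoc]
    · rw [Set.indicator_of_notMem (by rw [mem_ball_zero_iff, hn]; exact h1),
        Set.indicator_of_notMem (by exact h1), smul_zero, zero_mul]
  -- The product formula for integrals needs no integrability, so F and G stay arbitrary.
  rw [setIntegral_congr_fun (measurableSet_Ioi.prod measurableSet_Ioo) h,
    Measure.volume_eq_prod,
    setIntegral_prod_mul ((Set.Iio (1 : ℝ)).indicator fun r => r * F r) G]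
  congr 1
  · rw [setIntegral_indicator measurableSet_Iio, Set.Ioi_inter_Iio,
      intervalIntegral.integral_of_le zero_le_one, integral_Ioc_eq_integral_Ioo]
  · rw [intervalIntegral.integral_of_le (by linarith [Real.pi_pos]), integral_Ioc_eq_integral_Ioo]

/-- On the disc the arguments of F and G lie in [0, 1] and [-π, π]. The branch cut of `Complex.arg`
only requires measurability; boundedness later supplies both L² and all integrability claims. -/
theorem memLp_top_norm_mul_arg {F G : ℝ → ℝ} (hF : Continuous F) (hG : Continuous G) :
    MemLp (fun z : ℂ => F ‖z‖ * G (Complex.arg z)) ⊤ (volume.restrict unitDisc) := by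
  obtain ⟨A, hA⟩ := (isCompact_Icc (a := (0 : ℝ)) (b := 1)).exists_bound_of_continuousOn
    hF.continuousOn
  obtain ⟨B, hB⟩ := (isCompact_Icc (a := -Real.pi) (b := Real.pi)).exists_bound_of_continuousOn
    hG.continuousOn
  refine memLp_top_of_bound (C := A * B) ?_ ?_
  · exact ((hF.measurable.comp measurable_norm).mul
      (hG.measurable.comp Complex.measurable_arg)).aestronglyMeasurable
  · refine (ae_restrict_iff' measurableSet_ball).2 (Filter.Eventually.of_forall fun z hz => ?_)
    have hz' : ‖z‖ < 1 := mem_ball_zero_iff.1 hz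
    have h1 := hA ‖z‖ ⟨norm_nonneg z, hz'.le⟩
    have h2 := hB (Complex.arg z) ⟨(Complex.neg_pi_lt_arg z).le, Complex.arg_le_pi z⟩
    rw [norm_mul]
    exact mul_le_mul h1 h2 (norm_nonneg _) ((norm_nonneg _).trans h1)

theorem integral_cos_intCast_mul (m : ℤ) :
    ∫ θ in (-Real.pi)..Real.pi, Real.cos (m * θ) = if m = 0 then 2 * Real.pi else 0 := by
  split_ifs with h
  · subst h
    simp
    ring
  · have hm : (m : ℝ) ≠ 0 := by exact_mod_cast h
    rw [intervalIntegral.integral_comp_mul_left _ hm, integral_cos, mul_neg, Real.sin_neg,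
      Real.sin_int_mul_pi]
    simp

theorem integral_sin_intCast_mul (m : ℤ) :
    ∫ θ in (-Real.pi)..Real.pi, Real.sin (m * θ) = 0 := by
  have h := intervalIntegral.integral_comp_neg (a := -Real.pi) (b := Real.pi)
    fun θ => Real.sin (m * θ)
  simp only [mul_neg, Real.sin_neg, intervalIntegral.integral_neg, neg_neg] at h
  linarith

theorem integral_cos_mul_cos (a b : ℕ) :
    ∫ θ in (-Real.pi)..Real.pi, Real.cos (a * θ) * Real.cos (b * θ) =
      if a = b then (if b = 0 then 2 * Real.pi else Real.pi) else 0 := by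
  have h : ∀ θ : ℝ, Real.cos (a * θ) * Real.cos (b * θ) =
      (Real.cos (((a - b : ℤ) : ℝ) * θ) + Real.cos (((a + b : ℤ) : ℝ) * θ)) / 2 := by
    intro θ
    push_cast
    rw [sub_mul, add_mul, Real.cos_sub, Real.cos_add]
    ring
  simp only [h]
  rw [intervalIntegral.integral_div, intervalIntegral.integral_add
    ((by fun_prop : Continuous _).intervalIntegrable _ _)
    ((by fun_prop : Continuous _).intervalIntegrable _ _), integral_cos_intCast_mul,
    integral_cos_intCast_mul]
  split_ifs <;> first | omega | ring

theorem integral_sin_mul_sin (a : ℕ) {b : ℕ} (hb : b ≠ 0) :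
    ∫ θ in (-Real.pi)..Real.pi, Real.sin (a * θ) * Real.sin (b * θ) =
      if a = b then Real.pi else 0 := by
  have h : ∀ θ : ℝ, Real.sin (a * θ) * Real.sin (b * θ) =
      (Real.cos (((a - b : ℤ) : ℝ) * θ) - Real.cos (((a + b : ℤ) : ℝ) * θ)) / 2 := by
    intro θ
    push_cast
    rw [sub_mul, add_mul, Real.cos_sub, Real.cos_add]
    ring
  simp only [h]
  rw [intervalIntegral.integral_div, intervalIntegral.integral_sub
    ((by fun_prop : Continuous _).intervalIntegrable _ _)
    ((by fun_prop : Continuous _).intervalIntegrable _ _), integral_cos_intCast_mul,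
    integral_cos_intCast_mul]
  split_ifs <;> first | omega | ring

theorem integral_sin_mul_cos (a b : ℕ) :
    ∫ θ in (-Real.pi)..Real.pi, Real.sin (a * θ) * Real.cos (b * θ) = 0 := by
  have h : ∀ θ : ℝ, Real.sin (a * θ) * Real.cos (b * θ) =
      (Real.sin (((a - b : ℤ) : ℝ) * θ) + Real.sin (((a + b : ℤ) : ℝ) * θ)) / 2 := by
    intro θ
    push_cast
    rw [sub_mul, add_mul, Real.sin_sub, Real.sin_add]
    ring
  simp only [h]
  rw [intervalIntegral.integral_div, intervalIntegral.integral_add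
    ((by fun_prop : Continuous _).intervalIntegrable _ _)
    ((by fun_prop : Continuous _).intervalIntegrable _ _), integral_sin_intCast_mul,
    integral_sin_intCast_mul]
  simp

/-! ### The finite expansion and its moments -/

/-- The angular factor of the expansion at the frequency `k`. -/
noncomputable def trigTerm (k : ℕ) (a b θ : ℝ) : ℝ :=
  (if k = 0 then 1 / 2 else 1) * a * Real.cos (k * θ) + b * Real.sin (k * θ)

theorem continuous_trigTerm (k : ℕ) (a b : ℝ) : Continuous (trigTerm k a b) := by
  unfold trigTerm
  fun_prop

/-- The weight 1/2 at k = 0 cancels the doubled norm of the constant mode, so all frequencies share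
the factor π. -/
theorem integral_trigTerm_mul_cos (k m : ℕ) (a b : ℝ) :
    ∫ θ in (-Real.pi)..Real.pi, trigTerm k a b θ * Real.cos (m * θ) =
      if k = m then Real.pi * a else 0 := by
  simp only [trigTerm, add_mul, mul_assoc]
  rw [intervalIntegral.integral_add ((by fun_prop : Continuous _).intervalIntegrable _ _)
    ((by fun_prop : Continuous _).intervalIntegrable _ _)]
  simp only [intervalIntegral.integral_const_mul, integral_cos_mul_cos, integral_sin_mul_cos]
  split_ifs <;> first | omega | ring

theorem integral_trigTerm_mul_sin (k : ℕ) {m : ℕ} (hm : m ≠ 0) (a b : ℝ) :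
    ∫ θ in (-Real.pi)..Real.pi, trigTerm k a b θ * Real.sin (m * θ) =
      if k = m then Real.pi * b else 0 := by
  simp only [trigTerm, add_mul, mul_assoc]
  rw [intervalIntegral.integral_add ((by fun_prop : Continuous _).intervalIntegrable _ _)
    ((by fun_prop : Continuous _).intervalIntegrable _ _)]
  simp only [mul_comm (Real.cos _) (Real.sin _), intervalIntegral.integral_const_mul,
    integral_sin_mul_sin _ hm, integral_sin_mul_cos]
  split_ifs <;> first | omega | ring

theorem muntzTrigExpansion_eq_sum (N : ℕ) (p q : ℕ → ℕ → ℝ) (z : ℂ) :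
    muntzTrigExpansion N p q z = ∑ n ∈ Finset.range N, ∑ k ∈ Finset.range (N - n),
      muntzLegendre k n ‖z‖ * trigTerm k (p n k) (q n k) (Complex.arg z) := by
  rw [muntzTrigExpansion, Finset.mul_sum, ← Finset.sum_add_distrib, ← Finset.sum_add_distrib]
  refine Finset.sum_congr rfl fun n hn => ?_
  -- Splits off k = 0 from 1 ≤ k ≤ N - (n + 1); the sine vanishes there, so `q n 0` plays no role.
  have hN : N - n = (N - (n + 1)) + 1 := by
    have := Finset.mem_range.1 hn
    omega
  rw [hN, Finset.range_eq_Ico, Finset.sum_eq_sum_Ico_succ_bot (Nat.succ_pos _), add_assoc,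
    ← Finset.sum_add_distrib, zero_add]
  congr 1
  · simp [trigTerm]
    ring
  · refine Finset.sum_congr rfl fun k hk => ?_
    have hk0 : k ≠ 0 := by
      have := (Finset.mem_Icc.1 hk).1
      omega
    rw [trigTerm, if_neg hk0]
    ring

theorem continuous_muntzLegendre (k n : ℕ) : Continuous (muntzLegendre k n) := by
  unfold muntzLegendre
  fun_prop

theorem integral_muntzLegendre (k l n : ℕ) :
    ∫ r in (0 : ℝ)..1, r * (muntzLegendre k n r * r ^ (2 * l + k)) = muntzMoment k l n := by
  have h : ∀ r : ℝ, r * (muntzLegendre k n r * r ^ (2 * l + k)) =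
      ∑ s ∈ Finset.range (n + 1), muntzLegendreCoeff k n s * r ^ (2 * l + 2 * s + 2 * k + 1) := by
    intro r
    rw [muntzLegendre, Finset.sum_mul, Finset.mul_sum]
    exact Finset.sum_congr rfl fun s _ => by ring
  simp only [h]
  rw [intervalIntegral.integral_finsetSum fun s _ =>
    (by fun_prop : Continuous _).intervalIntegrable _ _, muntzMoment]
  refine Finset.sum_congr rfl fun s _ => ?_
  rw [intervalIntegral.integral_const_mul, integral_pow, one_pow, zero_pow (by omega), sub_zero,
    mul_one_div]
  congr 1
  push_cast
  ring

theorem memLp_top_muntzTrigExpansion (N : ℕ) (p q : ℕ → ℕ → ℝ) :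
    MemLp (muntzTrigExpansion N p q) ⊤ (volume.restrict unitDisc) := by
  rw [funext (muntzTrigExpansion_eq_sum N p q)]
  exact memLp_finsetSum _ fun n _ => memLp_finsetSum _ fun k _ =>
    memLp_top_norm_mul_arg (continuous_muntzLegendre k n) (continuous_trigTerm k _ _)

theorem integrableOn_muntzTrigExpansion_mul (N : ℕ) (p q : ℕ → ℕ → ℝ) (e : ℕ) {G : ℝ → ℝ}
    (hG : Continuous G) :
    IntegrableOn (fun z => muntzTrigExpansion N p q z * (‖z‖ ^ e * G (Complex.arg z)))
      unitDisc := by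
  have : IsFiniteMeasure (volume.restrict unitDisc) := isFiniteMeasure_restrict.2 (by
    exact measure_ball_lt_top.ne)
  have h : MemLp (fun z => muntzTrigExpansion N p q z * (‖z‖ ^ e * G (Complex.arg z))) ⊤
      (volume.restrict unitDisc) :=
    (memLp_top_norm_mul_arg (F := fun r => r ^ e) (by fun_prop) hG).mul
      (memLp_top_muntzTrigExpansion N p q)
  exact h.integrable le_top

theorem setIntegral_muntzTrigExpansion_mul (N : ℕ) (p q : ℕ → ℕ → ℝ) (e : ℕ) {G : ℝ → ℝ}
    (hG : Continuous G) :
    ∫ z in unitDisc, muntzTrigExpansion N p q z * (‖z‖ ^ e * G (Complex.arg z)) =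
      ∑ n ∈ Finset.range N, ∑ k ∈ Finset.range (N - n),
        (∫ r in (0 : ℝ)..1, r * (muntzLegendre k n r * r ^ e)) *
          ∫ θ in (-Real.pi)..Real.pi, trigTerm k (p n k) (q n k) θ * G θ := by
  have : IsFiniteMeasure (volume.restrict unitDisc) := isFiniteMeasure_restrict.2 (by
    exact measure_ball_lt_top.ne)
  have h : ∀ z : ℂ, muntzTrigExpansion N p q z * (‖z‖ ^ e * G (Complex.arg z)) =
      ∑ n ∈ Finset.range N, ∑ k ∈ Finset.range (N - n),
        (muntzLegendre k n ‖z‖ * ‖z‖ ^ e) *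
          (trigTerm k (p n k) (q n k) (Complex.arg z) * G (Complex.arg z)) := by
    intro z
    rw [muntzTrigExpansion_eq_sum, Finset.sum_mul]
    refine Finset.sum_congr rfl fun n _ => ?_
    rw [Finset.sum_mul]
    exact Finset.sum_congr rfl fun k _ => by ring
  have hint : ∀ n k : ℕ, Integrable (fun z : ℂ => (muntzLegendre k n ‖z‖ * ‖z‖ ^ e) *
      (trigTerm k (p n k) (q n k) (Complex.arg z) * G (Complex.arg z)))
      (volume.restrict unitDisc) := fun n k =>
    (memLp_top_norm_mul_arg (F := fun r => muntzLegendre k n r * r ^ e)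
      (G := fun θ => trigTerm k (p n k) (q n k) θ * G θ)
      ((continuous_muntzLegendre k n).mul (continuous_pow e))
      ((continuous_trigTerm k _ _).mul hG)).integrable le_top
  simp only [h]
  rw [integral_finsetSum _ fun n _ => integrable_finsetSum _ fun k _ => hint n k]
  refine Finset.sum_congr rfl fun n _ => ?_
  rw [integral_finsetSum _ fun k _ => hint n k]
  exact Finset.sum_congr rfl fun k _ => setIntegral_unitDisc_norm_mul_arg
    (fun r => muntzLegendre k n r * r ^ e) fun θ => trigTerm k (p n k) (q n k) θ * G θ

/-- In the index triangle n + k < N, the frequency m retains exactly N - m values of n, as many as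
there are entries on the m-th superdiagonal. -/
theorem sum_range_sum_range_ite (N m : ℕ) (c : ℕ → ℕ → ℝ) :
    ∑ n ∈ Finset.range N, ∑ k ∈ Finset.range (N - n), (if k = m then c n k else 0) =
      ∑ n ∈ Finset.range (N - m), c n m := by
  simp only [Finset.sum_ite_eq', Finset.mem_range]
  rw [← Finset.sum_filter]
  refine Finset.sum_congr ?_ fun _ _ => rfl
  ext n
  simp only [Finset.mem_filter, Finset.mem_range]
  omega

theorem setIntegral_muntzTrigExpansion_mul_cos (N : ℕ) (p q : ℕ → ℕ → ℝ) (l m : ℕ) :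
    ∫ z in unitDisc, muntzTrigExpansion N p q z *
        (‖z‖ ^ (2 * l + m) * Real.cos (m * Complex.arg z)) =
      Real.pi * ∑ n ∈ Finset.range (N - m), muntzMoment m l n * p n m := by
  rw [setIntegral_muntzTrigExpansion_mul N p q _ (G := fun θ => Real.cos (m * θ)) (by fun_prop),
    Finset.mul_sum, ← sum_range_sum_range_ite N m fun n k => Real.pi * (muntzMoment k l n * p n k)]
  refine Finset.sum_congr rfl fun n _ => Finset.sum_congr rfl fun k _ => ?_
  rw [integral_trigTerm_mul_cos]
  split_ifs with h
  · subst h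
    rw [integral_muntzLegendre]
    ring
  · rw [mul_zero]

theorem setIntegral_muntzTrigExpansion_mul_sin (N : ℕ) (p q : ℕ → ℕ → ℝ) (l : ℕ) {m : ℕ}
    (hm : m ≠ 0) :
    ∫ z in unitDisc, muntzTrigExpansion N p q z *
        (‖z‖ ^ (2 * l + m) * Real.sin (m * Complex.arg z)) =
      Real.pi * ∑ n ∈ Finset.range (N - m), muntzMoment m l n * q n m := by
  rw [setIntegral_muntzTrigExpansion_mul N p q _ (G := fun θ => Real.sin (m * θ)) (by fun_prop),
    Finset.mul_sum, ← sum_range_sum_range_ite N m fun n k => Real.pi * (muntzMoment k l n * q n k)]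
  refine Finset.sum_congr rfl fun n _ => Finset.sum_congr rfl fun k _ => ?_
  rw [integral_trigTerm_mul_sin _ hm]
  split_ifs with h
  · subst h
    rw [integral_muntzLegendre]
    ring
  · rw [mul_zero]

/-! ### Matching the data: existence and uniqueness of the coefficients -/

theorem hasLinDtNValue_cos_cos (N : ℕ) (p q : ℕ → ℕ → ℝ) (l k : ℕ) :
    HasLinDtNValue (muntzTrigExpansion N p q) (cosMode (l + 1)) (cosMode (l + 1 + k))
      (((l : ℝ) + 1) * (l + 1 + k) * Real.pi *
        ∑ n ∈ Finset.range (N - k), muntzMoment k l n * p n k) := by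
  have hc := fun z hz => linDtNIntegrand_cos_cos (muntzTrigExpansion N p q) l k (z := z) hz
  refine ⟨IntegrableOn.congr_fun (Integrable.const_mul
    (integrableOn_muntzTrigExpansion_mul N p q (2 * l + k)
      (G := fun θ => Real.cos (k * θ)) (by fun_prop)) _)
    (fun z hz => (hc z hz).symm) measurableSet_ball, ?_⟩
  rw [setIntegral_congr_fun measurableSet_ball hc, integral_const_mul,
    setIntegral_muntzTrigExpansion_mul_cos]
  ring

theorem hasLinDtNValue_cos_sin (N : ℕ) (p q : ℕ → ℕ → ℝ) (l : ℕ) {k : ℕ} (hk : k ≠ 0) :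
    HasLinDtNValue (muntzTrigExpansion N p q) (cosMode (l + 1)) (sinMode (l + 1 + k))
      (((l : ℝ) + 1) * (l + 1 + k) * Real.pi *
        ∑ n ∈ Finset.range (N - k), muntzMoment k l n * q n k) := by
  have hc := fun z hz => linDtNIntegrand_cos_sin (muntzTrigExpansion N p q) l k (z := z) hz
  refine ⟨IntegrableOn.congr_fun (Integrable.const_mul
    (integrableOn_muntzTrigExpansion_mul N p q (2 * l + k)
      (G := fun θ => Real.sin (k * θ)) (by fun_prop)) _)
    (fun z hz => (hc z hz).symm) measurableSet_ball, ?_⟩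
  rw [setIntegral_congr_fun measurableSet_ball hc, integral_const_mul,
    setIntegral_muntzTrigExpansion_mul_sin N p q l hk]
  ring

/-- The factor sin(kφ) is identically zero at k = 0, for every γ. -/
theorem hasLinDtNValue_cos_sin_self (γ : ℂ → ℝ) (l : ℕ) :
    HasLinDtNValue γ (cosMode (l + 1)) (sinMode (l + 1)) 0 := by
  have hc : ∀ z ∈ unitDisc, linDtNIntegrand γ (cosMode (l + 1)) (sinMode (l + 1)) z = 0 := by
    intro z hz
    have := linDtNIntegrand_cos_sin γ l 0 hz
    simpa using this
  refine ⟨integrableOn_zero.congr_fun (fun z hz => (hc z hz).symm) measurableSet_ball, ?_⟩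
  rw [setIntegral_congr_fun measurableSet_ball hc, integral_zero]

theorem HasLinDtNValue.unique {γ f g : ℂ → ℝ} {a b : ℝ} (ha : HasLinDtNValue γ f g a)
    (hb : HasLinDtNValue γ f g b) : a = b :=
  ha.2.symm.trans hb.2

theorem FreqMatrix.entry_apply {N : ℕ} (K : FreqMatrix N) (i j : Finset.Icc 1 N) :
    K.entry i j = K i j :=
  dif_pos ⟨i.2, j.2⟩

/-- The inversion formula characterizes the solution of the moment equations at frequency `k`. -/
theorem eq_inversionCoeff_iff {N : ℕ} (K : FreqMatrix N) (k : ℕ) (p : ℕ → ℝ) :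
    (∀ n < N - k, p n = inversionCoeff K n k) ↔
    ∀ l < N - k, K.entry (l + 1) (l + 1 + k) = ((l : ℝ) + 1) * (l + 1 + k) * Real.pi *
      ∑ n ∈ Finset.range (N - k), muntzMoment k l n * p n := by
  simp only [inversionCoeff_eq]
  rw [← muntzMoment_system_iff k (N - k)
    (fun l => K.entry (l + 1) (l + 1 + k) / ((l + 1) * (l + 1 + k) * Real.pi)) p]
  refine forall₂_congr fun l _ => ?_
  have h : ((l : ℝ) + 1) * (l + 1 + k) * Real.pi ≠ 0 := by
    have := Real.pi_pos
    positivity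
  rw [div_eq_iff h, mul_comm]

theorem hasLinDtNValue_cos_cos_inversionCoeff {N : ℕ} (K : FreqMatrix N) (q : ℕ → ℕ → ℝ)
    {i j : ℕ} (hi : 1 ≤ i) (hij : i ≤ j) (hj : j ≤ N) :
    HasLinDtNValue (muntzTrigExpansion N (inversionCoeff K) q) (cosMode i) (cosMode j)
      (K.entry i j) := by
  obtain ⟨l, rfl⟩ := Nat.exists_eq_add_of_le' hi
  obtain ⟨k, rfl⟩ := Nat.exists_eq_add_of_le hij
  rw [(eq_inversionCoeff_iff K k fun n => inversionCoeff K n k).1 (fun _ _ => rfl) l (by omega)]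
  exact hasLinDtNValue_cos_cos N _ q l k

theorem hasLinDtNValue_cos_sin_inversionCoeff {N : ℕ} (K : FreqMatrix N) (p : ℕ → ℕ → ℝ)
    {i j : ℕ} (hi : 1 ≤ i) (hij : i < j) (hj : j ≤ N) :
    HasLinDtNValue (muntzTrigExpansion N p (inversionCoeff K)) (cosMode i) (sinMode j)
      (K.entry i j) := by
  obtain ⟨l, rfl⟩ := Nat.exists_eq_add_of_le' hi
  obtain ⟨k, rfl⟩ := Nat.exists_eq_add_of_le hij.le
  rw [(eq_inversionCoeff_iff K k fun n => inversionCoeff K n k).1 (fun _ _ => rfl) l (by omega)]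
  exact hasLinDtNValue_cos_sin N p _ l (by omega)

/-- The inversion formula reads only entries on or above the diagonal; the rest follow because the
matrices obey the same symmetries as the form. -/
theorem isLinDtNData_inversionCoeff {N : ℕ} {Kcc Kcs : FreqMatrix N}
    (hcc : Kcc.transpose = Kcc) (hcs : Kcs = -Kcs.transpose) :
    IsLinDtNData N (muntzTrigExpansion N (inversionCoeff Kcc) (inversionCoeff Kcs))
      Kcc Kcc Kcs.transpose Kcs := by
  intro i j
  have hi := Finset.mem_Icc.1 i.2
  have hj := Finset.mem_Icc.1 j.2
  have hcc' : ∀ a b, Kcc a b = Kcc b a := fun a b => congrFun (congrFun hcc.symm a) b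
  have hcs' : ∀ a b, Kcs a b = -Kcs b a := fun a b => congrFun (congrFun hcs a) b
  have h1 : HasLinDtNValue (muntzTrigExpansion N (inversionCoeff Kcc) (inversionCoeff Kcs))
      (cosMode i) (cosMode j) (Kcc i j) := by
    rcases le_total (i : ℕ) j with h | h
    · rw [← FreqMatrix.entry_apply Kcc i j]
      exact hasLinDtNValue_cos_cos_inversionCoeff Kcc _ hi.1 h hj.2
    · rw [hcc', ← FreqMatrix.entry_apply Kcc j i]
      exact (hasLinDtNValue_cos_cos_inversionCoeff Kcc _ hj.1 h hi.2).symm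
  have h2 : HasLinDtNValue (muntzTrigExpansion N (inversionCoeff Kcc) (inversionCoeff Kcs))
      (cosMode i) (sinMode j) (Kcs i j) := by
    rcases lt_trichotomy (i : ℕ) j with h | h | h
    · rw [← FreqMatrix.entry_apply Kcs i j]
      exact hasLinDtNValue_cos_sin_inversionCoeff Kcs _ hi.1 h hj.2
    · obtain rfl : i = j := Subtype.ext h
      have h0 : Kcs i i = 0 := self_eq_neg.1 (hcs' i i)
      obtain ⟨l, hl⟩ := Nat.exists_eq_add_of_le' hi.1
      rw [h0, hl]
      exact hasLinDtNValue_cos_sin_self _ l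
    -- Below the diagonal: pass from (cos j, sin i) to (sin j, cos i) at the cost of a sign, then
    -- use symmetry of the form.
    · rw [hcs', ← FreqMatrix.entry_apply Kcs j i]
      exact (hasLinDtNValue_cos_sin_inversionCoeff Kcs _ hj.1 h hi.2).sin_cos.symm
  refine ⟨h1, h1.sin_sin, ?_, h2⟩
  rw [Matrix.transpose_apply, hcs']
  exact h2.sin_cos

/-- A form value is unique, so the prescribed entries must satisfy the moment equations, which
determine the coefficients. -/
theorem IsLinDtNData.eq_inversionCoeff_cos {N : ℕ} {p q : ℕ → ℕ → ℝ}
    {Kcc Kss Ksc Kcs : FreqMatrix N}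
    (h : IsLinDtNData N (muntzTrigExpansion N p q) Kcc Kss Ksc Kcs) {n k : ℕ} (hnk : n + k < N) :
    p n k = inversionCoeff Kcc n k := by
  refine (eq_inversionCoeff_iff Kcc k fun n => p n k).2 (fun l hl => ?_) n (by omega)
  have hi : l + 1 ∈ Finset.Icc 1 N := Finset.mem_Icc.2 ⟨by omega, by omega⟩
  have hj : l + 1 + k ∈ Finset.Icc 1 N := Finset.mem_Icc.2 ⟨by omega, by omega⟩
  exact (Kcc.entry_apply ⟨l + 1, hi⟩ ⟨l + 1 + k, hj⟩).trans
    ((h ⟨l + 1, hi⟩ ⟨l + 1 + k, hj⟩).1.unique (hasLinDtNValue_cos_cos N p q l k))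

theorem IsLinDtNData.eq_inversionCoeff_sin {N : ℕ} {p q : ℕ → ℕ → ℝ}
    {Kcc Kss Ksc Kcs : FreqMatrix N}
    (h : IsLinDtNData N (muntzTrigExpansion N p q) Kcc Kss Ksc Kcs) {n k : ℕ} (hk : 1 ≤ k)
    (hnk : n + k < N) : q n k = inversionCoeff Kcs n k := by
  refine (eq_inversionCoeff_iff Kcs k fun n => q n k).2 (fun l hl => ?_) n (by omega)
  have hi : l + 1 ∈ Finset.Icc 1 N := Finset.mem_Icc.2 ⟨by omega, by omega⟩
  have hj : l + 1 + k ∈ Finset.Icc 1 N := Finset.mem_Icc.2 ⟨by omega, by omega⟩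
  exact (Kcs.entry_apply ⟨l + 1, hi⟩ ⟨l + 1 + k, hj⟩).trans
    ((h ⟨l + 1, hi⟩ ⟨l + 1 + k, hj⟩).2.2.2.unique
      (hasLinDtNValue_cos_sin N p q l (by omega)))

theorem mainTheorem4 (N : ℕ) (Kcc Kss Ksc Kcs : FreqMatrix N)
    (hcc_symm : Kcc.transpose = Kcc) (hss_symm : Kss.transpose = Kss)
    (hcs_sc : Kcs = Ksc.transpose)
    (hcs_anti : Kcs = -Kcs.transpose) (hsc_anti : Ksc = -Ksc.transpose)
    (hcc_ss : Kcc = Kss) :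
    ∃ γ : ℂ → ℝ,
      MemLp γ 2 (volume.restrict unitDisc) ∧
      IsLinDtNData N γ Kcc Kss Ksc Kcs ∧
      (∀ j : ℕ, j ≤ N →
        HasLinDtNValue γ (cosMode 0) (cosMode j) 0 ∧ HasLinDtNValue γ (cosMode j) (cosMode 0) 0 ∧
        HasLinDtNValue γ (cosMode 0) (sinMode j) 0 ∧ HasLinDtNValue γ (sinMode j) (cosMode 0) 0) ∧
      ∃ p q : ℕ → ℕ → ℝ,
        (∀ z ∈ unitDisc, γ z = muntzTrigExpansion N p q z) ∧
        (∀ n k : ℕ, n + k < N → p n k = inversionCoeff Kcc n k) ∧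
        (∀ n k : ℕ, 1 ≤ k → n + k < N → q n k = inversionCoeff Kcs n k) ∧
        (∀ p' q' : ℕ → ℕ → ℝ, IsLinDtNData N (muntzTrigExpansion N p' q') Kcc Kss Ksc Kcs →
          (∀ n k : ℕ, n + k < N → p' n k = p n k) ∧
          (∀ n k : ℕ, 1 ≤ k → n + k < N → q' n k = q n k)) := by
  subst hcc_ss
  have hsc : Ksc = Kcs.transpose := by rw [hcs_sc, Matrix.transpose_transpose]
  have : IsFiniteMeasure (volume.restrict unitDisc) :=
    isFiniteMeasure_restrict.2 measure_ball_lt_top.ne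
  refine ⟨muntzTrigExpansion N (inversionCoeff Kcc) (inversionCoeff Kcs),
    (memLp_top_muntzTrigExpansion N _ _).mono_exponent le_top, ?_, fun j _ =>
      ⟨hasLinDtNValue_cosMode_zero _ _, (hasLinDtNValue_cosMode_zero _ _).symm,
        hasLinDtNValue_cosMode_zero _ _, (hasLinDtNValue_cosMode_zero _ _).symm⟩,
    inversionCoeff Kcc, inversionCoeff Kcs, fun _ _ => rfl, fun _ _ _ => rfl, fun _ _ _ _ => rfl,
    fun p' q' h => ⟨fun n k hnk => h.eq_inversionCoeff_cos hnk,
      fun n k hk hnk => h.eq_inversionCoeff_sin hk hnk⟩⟩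
  rw [hsc]
  exact isLinDtNData_inversionCoeff hcc_symm hcs_anti
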